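/- Let $\theta_1,\theta_2>0$ with $\theta_1<2\theta_2$ and $\theta_2<2\theta_1$, and let $H:\mathbb{R}_+^2\to\mathbb{R}_+^2$, where $\mathbb{R}_+^2=\{x_1\ge 0,\ x_2\ge 0\}$, be the quadratic operator $$H(x_1,x_2)=\Big(\tfrac{\theta_1x_1}{2}(x_1+2x_2),\ \tfrac{\theta_2x_2}{2}(x_2+2x_1)\Big),$$ with fixed points $E_1=(\tfrac{2}{\theta_1},0)$, $E_2=(0,\tfrac{2}{\theta_2})$ and $$\overline{E}=(\overline{x}_1,\overline{x}_2)=\Big(\tfrac{4\theta_1-2\theta_2}{3\theta_1\theta_2},\ \tfrac{4\theta_2-2\theta_1}{3\theta_1\theta_2}\Big).$$ Then $\overline{E}$ is a saddle. The eigenvalues of the Jacobian matrix $J(\overline{E})$ of $H$ at $\overline{E}$ are $\lambda_1=2$ and $$\lambda_2=\frac{2(\theta_1^2+\theta_2^2-\theta_1\theta_2)}{3\theta_1\theta_2},\qquad |\lambda_2|<1,$$ and $(1,-\theta_2/\theta_1)$ is an eigenvector of $J(\overline{E})$ for $\lambda_2$. Moreover this vector is tangent at $\overline{E}$ to the stable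 curve of $\overline{E}$. That is, call a function $\gamma$ on $[0,2/\theta_1]$ a stable curve of $\overline{E}$ if it is continuous, its graph $x_2=\gamma(x_1)$ is invariant under $H$ (mapped into itself) and passes through $E_1$, $E_2$ and $\overline{E}$, and the points $(x_1,\gamma(x_1))$ with $0<x_1<2/\theta_1$ are exactly the points $x\in\mathbb{R}_+^2$ with $\lim_{m\to\infty}H^m(x)=\overline{E}$. Then such a $\gamma$ exists, and for every such $\gamma$ the parametrized curve $s\mapsto(s,\gamma(s))$ is differentiable at $s=\overline{x}_1$ with derivative $(1,-\theta_2/\theta_1)$. -/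

import Mathlib

open Filter Topology Set

noncomputable section

/-- The quadratic operator `x_k' = (θ_k x_k / 2) (x_k + 2 ∑_{i ≠ k} x_i)`. -/
def quadOp {n : ℕ} (θ : Fin n → ℝ) (x : Fin n → ℝ) : Fin n → ℝ :=
  fun k => θ k * x k / 2 * (x k + 2 * ∑ i ∈ Finset.univ.erase k, x i)

/-- The Jacobian matrix of a map of `ℝⁿ` at a point. -/
def jacobian {n : ℕ} (F : (Fin n → ℝ) → (Fin n → ℝ)) (x : Fin n → ℝ) :
    Matrix (Fin n) (Fin n) ℝ :=
  LinearMap.toMatrix' (fderiv ℝ F x).toLinearMap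

/-- `p` is a saddle fixed point of `F`: no (complex) eigenvalue of the Jacobian at `p` lies on the
unit circle, at least one lies inside and at least one lies outside. -/
structure IsSaddle {n : ℕ} (F : (Fin n → ℝ) → (Fin n → ℝ)) (p : Fin n → ℝ) : Prop where
  fixed : F p = p
  differentiable : DifferentiableAt ℝ F p
  hyperbolic : ∀ z ∈ spectrum ℂ ((jacobian F p).map Complex.ofReal), ‖z‖ ≠ 1
  stable : ∃ z ∈ spectrum ℂ ((jacobian F p).map Complex.ofReal), ‖z‖ < 1
  unstable : ∃ z ∈ spectrum ℂ ((jacobian F p).map Complex.ofReal), 1 < ‖z‖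

/-- The stable set of `p` for the dynamics of `F` on the closed nonnegative orthant: the initial
points whose trajectory converges to `p`. -/
def stableSet {n : ℕ} (F : (Fin n → ℝ) → (Fin n → ℝ)) (p : Fin n → ℝ) : Set (Fin n → ℝ) :=
  {x | 0 ≤ x ∧ Tendsto (fun m : ℕ => F^[m] x) atTop (𝓝 p)}

/-- The fixed point `Ē` of the two-dimensional operator with both coordinates non-zero. -/
def posFixedPoint (θ₁ θ₂ : ℝ) : Fin 2 → ℝ :=
  ![(4 * θ₁ - 2 * θ₂) / (3 * θ₁ * θ₂), (4 * θ₂ - 2 * θ₁) / (3 * θ₁ * θ₂)]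

/-- The curve `x₂ = γ(x₁)`, `0 ≤ x₁ ≤ 2 / θ₁`, is the stable curve of `Ē`: it is a continuous
invariant curve through `E₁ = (2 / θ₁, 0)`, `E₂ = (0, 2 / θ₂)` and `Ē` whose points other than the
end points `E₁`, `E₂` are exactly the points with trajectory converging to `Ē`. -/
structure IsStableCurve (θ₁ θ₂ : ℝ) (γ : ℝ → ℝ) : Prop where
  continuousOn : ContinuousOn γ (Icc 0 (2 / θ₁))
  through_E₁ : γ (2 / θ₁) = 0
  through_E₂ : γ 0 = 2 / θ₂
  through_E : γ (posFixedPoint θ₁ θ₂ 0) = posFixedPoint θ₁ θ₂ 1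
  invariant : MapsTo (quadOp ![θ₁, θ₂]) ((fun s => ![s, γ s]) '' Icc 0 (2 / θ₁))
    ((fun s => ![s, γ s]) '' Icc 0 (2 / θ₁))
  stable : (fun s => ![s, γ s]) '' Ioo 0 (2 / θ₁) =
    stableSet (quadOp ![θ₁, θ₂]) (posFixedPoint θ₁ θ₂)

end

/-! The operator H is homogeneous of degree two, so it splits into a one-dimensional ratio dynamics
and a radial doubling. The radial part is measured by the escape rate G = `potential`. It satisfies
G(Hx) = 2 G(x) and G(tx) = log t + G(x), and it is continuous and monotone on the nonzero quadrant.
Convergence to the fixed point forces G = 0, since G doubles at every step. Conversely, G = 0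
recovers a point from its ratio u = x₂/x₁, and u converges to the fixed ratio p by `tendsto_ratio`.
So the stable set is {G = 0} in the open quadrant (`mem_stableSet_iff`). Strict monotonicity and
compactness make {G = 0} a continuous graph.

For the tangent, φ(u) = G(1, u) satisfies 2 φ(u) = log(θ₁(1 + 2u)/2) + φ(g(u)), where g is the ratio
map. Near p, g contracts, and the factor 2 turns a Lipschitz bound into differentiability at p
(`hasDerivAt_profile`). The curve is x₁ = exp(-φ(u)), x₂ = u x₁, so its slope there is p - 1/φ'(p) =
-θ₂/θ₁. The spectral claims are a 2 × 2 computation. -/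

/-- The parameter range in which the positive fixed point exists. -/
structure BalancedRates (θ₁ θ₂ : ℝ) : Prop where
  pos₁ : 0 < θ₁
  pos₂ : 0 < θ₂
  lt₁ : θ₁ < 2 * θ₂
  lt₂ : θ₂ < 2 * θ₁

/-! ### The operator in coordinates -/

theorem quadOp_two (θ₁ θ₂ : ℝ) (x : Fin 2 → ℝ) :
    quadOp ![θ₁, θ₂] x =
      ![θ₁ * x 0 / 2 * (x 0 + 2 * x 1), θ₂ * x 1 / 2 * (x 1 + 2 * x 0)] := by
  have h0 : (Finset.univ.erase 0 : Finset (Fin 2)) = {1} := by decide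
  have h1 : (Finset.univ.erase 1 : Finset (Fin 2)) = {0} := by decide
  ext i
  fin_cases i
  · simp [quadOp, h0]
  · simp [quadOp, h1]

theorem quadOp_two_zero (θ₁ θ₂ : ℝ) (x : Fin 2 → ℝ) :
    quadOp ![θ₁, θ₂] x 0 = θ₁ * x 0 / 2 * (x 0 + 2 * x 1) := by simp [quadOp_two]

theorem quadOp_two_one (θ₁ θ₂ : ℝ) (x : Fin 2 → ℝ) :
    quadOp ![θ₁, θ₂] x 1 = θ₂ * x 1 / 2 * (x 1 + 2 * x 0) := by simp [quadOp_two]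

theorem quadOp_smul (θ₁ θ₂ t : ℝ) (x : Fin 2 → ℝ) :
    quadOp ![θ₁, θ₂] (t • x) = t ^ 2 • quadOp ![θ₁, θ₂] x := by
  ext i
  fin_cases i <;> simp [quadOp_two] <;> ring

theorem continuous_quadOp_two (θ₁ θ₂ : ℝ) : Continuous (quadOp ![θ₁, θ₂]) := by
  have : quadOp ![θ₁, θ₂] = fun x =>
      ![θ₁ * x 0 / 2 * (x 0 + 2 * x 1), θ₂ * x 1 / 2 * (x 1 + 2 * x 0)] :=
    funext (quadOp_two θ₁ θ₂)
  rw [this]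
  refine continuous_pi fun i => ?_
  fin_cases i <;> simp <;> fun_prop

theorem pi_two_nonneg {x : Fin 2 → ℝ} : 0 ≤ x ↔ 0 ≤ x 0 ∧ 0 ≤ x 1 := by
  simp [Pi.le_def, Fin.forall_fin_two]

theorem pi_two_pos {x : Fin 2 → ℝ} : 0 < x ↔ 0 ≤ x 0 ∧ 0 ≤ x 1 ∧ 0 < x 0 + x 1 := by
  rw [Pi.lt_def, pi_two_nonneg, Fin.exists_fin_two]
  simp only [Pi.zero_apply]
  constructor
  · rintro ⟨⟨h0, h1⟩, h | h⟩ <;> exact ⟨h0, h1, by linarith⟩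
  · rintro ⟨h0, h1, h⟩
    refine ⟨⟨h0, h1⟩, ?_⟩
    by_contra! hc
    linarith [hc.1, hc.2]

theorem pi_two_eta (x : Fin 2 → ℝ) : ![x 0, x 1] = x := by
  ext i; fin_cases i <;> rfl

/-! ### The escape rate: functional equations, continuity, monotonicity -/

/-- A linear functional, positive on the quadrant, that equals `1` at both axial fixed points. -/
noncomputable def weight (θ₁ θ₂ : ℝ) (x : Fin 2 → ℝ) : ℝ := (θ₁ * x 0 + θ₂ * x 1) / 2

/-- The logarithmic growth of the weight in one step, relative to squaring. -/
noncomputable def growth (θ₁ θ₂ : ℝ) (x : Fin 2 → ℝ) : ℝ :=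
  Real.log (weight θ₁ θ₂ (quadOp ![θ₁, θ₂] x) / weight θ₁ θ₂ x ^ 2)

/-- The degree zero part of the logarithmic escape rate. -/
noncomputable def correction (θ₁ θ₂ : ℝ) (x : Fin 2 → ℝ) : ℝ :=
  ∑' k : ℕ, (1 / 2 : ℝ) ^ (k + 1) * growth θ₁ θ₂ ((quadOp ![θ₁, θ₂])^[k] x)

/-- The logarithmic escape rate: `lim 2⁻ᵐ log (weight (Hᵐ x))`. -/
noncomputable def potential (θ₁ θ₂ : ℝ) (x : Fin 2 → ℝ) : ℝ :=
  Real.log (weight θ₁ θ₂ x) + correction θ₁ θ₂ x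

theorem weight_smul (θ₁ θ₂ t : ℝ) (x : Fin 2 → ℝ) :
    weight θ₁ θ₂ (t • x) = t * weight θ₁ θ₂ x := by
  simp [weight]; ring

theorem continuous_weight (θ₁ θ₂ : ℝ) : Continuous (weight θ₁ θ₂) := by
  unfold weight; fun_prop

namespace BalancedRates

variable {θ₁ θ₂ : ℝ} (hb : BalancedRates θ₁ θ₂)
include hb

theorem weight_pos {x : Fin 2 → ℝ} (hx : 0 < x) : 0 < weight θ₁ θ₂ x := by
  obtain ⟨h0, h1, h⟩ := pi_two_pos.1 hx
  have := hb.pos₁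
  have := hb.pos₂
  unfold weight
  rcases h0.lt_or_eq with h | h
  · positivity
  · have : 0 < x 1 := by linarith
    positivity

theorem weight_mono {x y : Fin 2 → ℝ} (hxy : x ≤ y) : weight θ₁ θ₂ x ≤ weight θ₁ θ₂ y := by
  have h1 := mul_le_mul_of_nonneg_left (hxy 0) hb.pos₁.le
  have h2 := mul_le_mul_of_nonneg_left (hxy 1) hb.pos₂.le
  unfold weight
  linarith

omit hb in
theorem sq_weight_le {x : Fin 2 → ℝ} (hx : 0 ≤ x) :
    weight θ₁ θ₂ x ^ 2 ≤ weight θ₁ θ₂ (quadOp ![θ₁, θ₂] x) := by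
  obtain ⟨h0, h1⟩ := pi_two_nonneg.1 hx
  simp only [weight, quadOp_two_zero, quadOp_two_one]
  have := mul_nonneg (mul_nonneg h0 h1) (by nlinarith [sq_nonneg (θ₁ - θ₂), sq_nonneg θ₁, sq_nonneg θ₂] :
    0 ≤ θ₁ ^ 2 + θ₂ ^ 2 - θ₁ * θ₂)
  nlinarith

/-- The product (2θ₂ - θ₁)(2θ₁ - θ₂) > 0 gives θ₁² + θ₂² < (5/2) θ₁θ₂, which keeps the cross term
nonnegative. The constant 3 is not sharp; any finite bound on `growth` would make the series
converge. -/
theorem weight_quadOp_le {x : Fin 2 → ℝ} (hx : 0 ≤ x) :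
    weight θ₁ θ₂ (quadOp ![θ₁, θ₂] x) ≤ 3 * weight θ₁ θ₂ x ^ 2 := by
  obtain ⟨h0, h1⟩ := pi_two_nonneg.1 hx
  simp only [weight, quadOp_two_zero, quadOp_two_one]
  have := mul_nonneg (mul_nonneg h0 h1)
    (by nlinarith [mul_pos (sub_pos.2 hb.lt₁) (sub_pos.2 hb.lt₂), mul_pos hb.pos₁ hb.pos₂] :
    0 ≤ 3 * (θ₁ * θ₂) - θ₁ ^ 2 - θ₂ ^ 2)
  nlinarith [sq_nonneg (θ₁ * x 0), sq_nonneg (θ₂ * x 1)]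

theorem quadOp_pos {x : Fin 2 → ℝ} (hx : 0 < x) : 0 < quadOp ![θ₁, θ₂] x := by
  obtain ⟨h0, h1, h⟩ := pi_two_pos.1 hx
  have := hb.pos₁
  have := hb.pos₂
  rw [pi_two_pos, quadOp_two_zero, quadOp_two_one]
  refine ⟨by positivity, by positivity, ?_⟩
  rcases h0.lt_or_eq with h | h
  · positivity
  · have : 0 < x 1 := by linarith
    positivity

theorem iterate_pos {x : Fin 2 → ℝ} (hx : 0 < x) (k : ℕ) : 0 < (quadOp ![θ₁, θ₂])^[k] x := by
  induction k with
  | zero => exact hx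
  | succ k ih => rw [Function.iterate_succ_apply']; exact hb.quadOp_pos ih

theorem quadOp_mono {x y : Fin 2 → ℝ} (hx : 0 ≤ x) (hxy : x ≤ y) :
    quadOp ![θ₁, θ₂] x ≤ quadOp ![θ₁, θ₂] y := by
  obtain ⟨h0, h1⟩ := pi_two_nonneg.1 hx
  have h2 := hxy 0
  have h3 := hxy 1
  have := hb.pos₁
  have := hb.pos₂
  have h4 := h0.trans h2
  have h5 := h1.trans h3
  rw [Pi.le_def, Fin.forall_fin_two]
  simp only [quadOp_two_zero, quadOp_two_one]
  exact ⟨by gcongr, by gcongr⟩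

theorem iterate_mono {x y : Fin 2 → ℝ} (hx : 0 < x) (hxy : x ≤ y) (k : ℕ) :
    (quadOp ![θ₁, θ₂])^[k] x ≤ (quadOp ![θ₁, θ₂])^[k] y := by
  induction k with
  | zero => exact hxy
  | succ k ih =>
    simp only [Function.iterate_succ_apply']
    exact hb.quadOp_mono (hb.iterate_pos hx k).le ih

theorem growth_nonneg {x : Fin 2 → ℝ} (hx : 0 < x) : 0 ≤ growth θ₁ θ₂ x := by
  have := hb.weight_pos hx
  exact Real.log_nonneg ((one_le_div (by positivity)).2 (sq_weight_le hx.le))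

theorem growth_le {x : Fin 2 → ℝ} (hx : 0 < x) : growth θ₁ θ₂ x ≤ Real.log 3 := by
  have h1 := hb.weight_pos hx
  have h2 := hb.weight_pos (hb.quadOp_pos hx)
  exact Real.log_le_log (by positivity) ((div_le_iff₀ (by positivity)).2 (hb.weight_quadOp_le hx.le))

theorem log_weight_quadOp {x : Fin 2 → ℝ} (hx : 0 < x) :
    Real.log (weight θ₁ θ₂ (quadOp ![θ₁, θ₂] x)) =
      2 * Real.log (weight θ₁ θ₂ x) + growth θ₁ θ₂ x := by
  have h1 := hb.weight_pos hx
  have h2 := hb.weight_pos (hb.quadOp_pos hx)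
  rw [growth, Real.log_div h2.ne' (by positivity), Real.log_pow]
  push_cast
  ring

omit hb in
theorem growth_smul {x : Fin 2 → ℝ} {t : ℝ} (ht : 0 < t) :
    growth θ₁ θ₂ (t • x) = growth θ₁ θ₂ x := by
  rw [growth, growth, quadOp_smul, weight_smul, weight_smul, mul_pow,
    mul_div_mul_left _ _ (by positivity)]

theorem norm_term_le {x : Fin 2 → ℝ} (hx : 0 < x) (k : ℕ) :
    ‖(1 / 2 : ℝ) ^ (k + 1) * growth θ₁ θ₂ ((quadOp ![θ₁, θ₂])^[k] x)‖ ≤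
      (1 / 2 : ℝ) ^ (k + 1) * Real.log 3 := by
  have h1 := hb.growth_nonneg (hb.iterate_pos hx k)
  rw [Real.norm_of_nonneg (by positivity)]
  have h2 := hb.growth_le (hb.iterate_pos hx k)
  gcongr

omit hb in
theorem hasSum_bound : HasSum (fun k : ℕ => (1 / 2 : ℝ) ^ (k + 1) * Real.log 3) (Real.log 3) := by
  have h := (hasSum_geometric_two.mul_right (1 / 2 : ℝ)).mul_right (Real.log 3)
  simpa [pow_succ] using h

theorem summable_term {x : Fin 2 → ℝ} (hx : 0 < x) :
    Summable fun k : ℕ => (1 / 2 : ℝ) ^ (k + 1) * growth θ₁ θ₂ ((quadOp ![θ₁, θ₂])^[k] x) :=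
  .of_norm_bounded hasSum_bound.summable (hb.norm_term_le hx)

theorem abs_correction_le {x : Fin 2 → ℝ} (hx : 0 < x) :
    |correction θ₁ θ₂ x| ≤ Real.log 3 :=
  tsum_of_norm_bounded hasSum_bound (hb.norm_term_le hx)

theorem correction_quadOp {x : Fin 2 → ℝ} (hx : 0 < x) :
    2 * correction θ₁ θ₂ x = growth θ₁ θ₂ x + correction θ₁ θ₂ (quadOp ![θ₁, θ₂] x) := by
  rw [correction, (hb.summable_term hx).tsum_eq_zero_add, correction, mul_add, ← tsum_mul_left]
  congr 1
  · simp
  · refine tsum_congr fun k => ?_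
    rw [Function.iterate_succ_apply]
    ring

theorem potential_quadOp {x : Fin 2 → ℝ} (hx : 0 < x) :
    potential θ₁ θ₂ (quadOp ![θ₁, θ₂] x) = 2 * potential θ₁ θ₂ x := by
  rw [potential, potential, hb.log_weight_quadOp hx, mul_add, hb.correction_quadOp hx]
  ring

theorem potential_iterate {x : Fin 2 → ℝ} (hx : 0 < x) (m : ℕ) :
    potential θ₁ θ₂ ((quadOp ![θ₁, θ₂])^[m] x) = 2 ^ m * potential θ₁ θ₂ x := by
  induction m with
  | zero => simp
  | succ m ih =>
    rw [Function.iterate_succ_apply', hb.potential_quadOp (hb.iterate_pos hx m), ih]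
    ring

theorem potential_eq_zero_of_fixed {x : Fin 2 → ℝ} (hx : 0 < x)
    (h : quadOp ![θ₁, θ₂] x = x) : potential θ₁ θ₂ x = 0 := by
  have := hb.potential_quadOp hx
  rw [h] at this
  linarith

omit hb in
theorem iterate_smul (t : ℝ) (x : Fin 2 → ℝ) (k : ℕ) :
    (quadOp ![θ₁, θ₂])^[k] (t • x) = t ^ (2 ^ k) • (quadOp ![θ₁, θ₂])^[k] x := by
  induction k with
  | zero => simp
  | succ k ih =>
    rw [Function.iterate_succ_apply', ih, quadOp_smul, Function.iterate_succ_apply', ← pow_mul,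
      pow_succ 2 k]

theorem potential_smul {x : Fin 2 → ℝ} (hx : 0 < x) {t : ℝ} (ht : 0 < t) :
    potential θ₁ θ₂ (t • x) = Real.log t + potential θ₁ θ₂ x := by
  have : correction θ₁ θ₂ (t • x) = correction θ₁ θ₂ x := by
    refine tsum_congr fun k => ?_
    rw [iterate_smul, growth_smul (by positivity)]
  rw [potential, potential, this, weight_smul, Real.log_mul ht.ne' (hb.weight_pos hx).ne']
  ring

theorem continuousOn_growth : ContinuousOn (growth θ₁ θ₂) (Ioi 0) := by
  unfold growth
  have hw := continuous_weight θ₁ θ₂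
  have hq := continuous_quadOp_two θ₁ θ₂
  refine ContinuousOn.log (ContinuousOn.div (by fun_prop) (by fun_prop) ?_) ?_
  · intro x hx
    have := hb.weight_pos hx
    positivity
  · intro x hx
    have := hb.weight_pos hx
    have := hb.weight_pos (hb.quadOp_pos hx)
    positivity

theorem continuousOn_potential : ContinuousOn (potential θ₁ θ₂) (Ioi 0) := by
  refine ContinuousOn.add
    ((continuous_weight θ₁ θ₂).continuousOn.log fun x hx => (hb.weight_pos hx).ne') ?_
  refine continuousOn_tsum (fun k => ?_) hasSum_bound.summable fun k x hx => hb.norm_term_le hx k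
  exact continuousOn_const.mul (hb.continuousOn_growth.comp
    ((continuous_quadOp_two θ₁ θ₂).iterate k).continuousOn fun x hx => hb.iterate_pos hx k)

/-- Iterates keep their order, so monotonicity of the weight gives monotonicity of the potential up
to the bounded correction. A strict violation would double at each step and exceed that bound. -/
theorem potential_mono {x y : Fin 2 → ℝ} (hx : 0 < x) (hxy : x ≤ y) :
    potential θ₁ θ₂ x ≤ potential θ₁ θ₂ y := by
  have hy := hx.trans_le hxy
  by_contra! hlt
  have key : ∀ m : ℕ, (2 : ℝ) ^ m * (potential θ₁ θ₂ x - potential θ₁ θ₂ y) ≤ 2 * Real.log 3 := by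
    intro m
    rw [mul_sub, ← hb.potential_iterate hx, ← hb.potential_iterate hy, potential, potential]
    have h1 := abs_le.1 (hb.abs_correction_le (hb.iterate_pos hx m))
    have h2 := abs_le.1 (hb.abs_correction_le (hb.iterate_pos hy m))
    have h3 := Real.log_le_log (hb.weight_pos (hb.iterate_pos hx m))
      (hb.weight_mono (hb.iterate_mono hx hxy m))
    linarith [h1.2, h2.1]
  have ht : Tendsto (fun m : ℕ => (2 : ℝ) ^ m * (potential θ₁ θ₂ x - potential θ₁ θ₂ y))
      atTop atTop :=
    (tendsto_pow_atTop_atTop_of_one_lt one_lt_two).atTop_mul_const (sub_pos.2 hlt)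
  obtain ⟨m, hm⟩ := (ht.eventually_gt_atTop (2 * Real.log 3)).exists
  exact absurd (key m) (not_le.2 hm)

/-- There is room for t • x below y with some t > 1, and the scaling gains log t > 0. -/
theorem potential_lt_of_forall_lt {x y : Fin 2 → ℝ} (hx : 0 < x) (h : ∀ i, x i < y i) :
    potential θ₁ θ₂ x < potential θ₁ θ₂ y := by
  have ev : ∀ i, ∀ᶠ t : ℝ in 𝓝[>] 1, t * x i < y i := by
    intro i
    have hc : Tendsto (fun t : ℝ => t * x i) (𝓝[>] 1) (𝓝 (1 * x i)) :=
      ((continuous_id.mul continuous_const).tendsto 1).mono_left nhdsWithin_le_nhds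
    exact hc.eventually_lt_const (by simpa using h i)
  obtain ⟨t, ht, ht1⟩ := ((eventually_all.2 ev).and self_mem_nhdsWithin).exists
  have ht1 : 1 < t := ht1
  have htpos : 0 < t := by linarith
  have h1 := hb.potential_smul hx htpos
  have h2 : potential θ₁ θ₂ (t • x) ≤ potential θ₁ θ₂ y :=
    hb.potential_mono (smul_pos htpos hx) fun i => (ht i).le
  linarith [Real.log_pos ht1]

theorem potential_strictMono_snd {s t t' : ℝ} (hs : 0 < s) (ht : 0 ≤ t) (h : t < t') :
    potential θ₁ θ₂ ![s, t] < potential θ₁ θ₂ ![s, t'] := by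
  have := hb.pos₁
  have := hb.pos₂
  have hx : (0 : Fin 2 → ℝ) < ![s, t] := pi_two_pos.2 ⟨hs.le, ht, add_pos_of_pos_of_nonneg hs ht⟩
  have hy : (0 : Fin 2 → ℝ) < ![s, t'] := pi_two_pos.2 ⟨hs.le, ht.trans h.le, add_pos hs (ht.trans_lt h)⟩
  -- Only one coordinate has grown, but since s > 0 a single application of the operator makes both
  -- strictly larger.
  have key := hb.potential_lt_of_forall_lt (y := quadOp ![θ₁, θ₂] ![s, t']) (hb.quadOp_pos hx) (by
    rw [Fin.forall_fin_two]
    simp only [quadOp_two_zero, quadOp_two_one, Matrix.cons_val_zero, Matrix.cons_val_one]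
    exact ⟨by gcongr, mul_lt_mul'' (by gcongr) (by gcongr) (by positivity) (by positivity)⟩)
  rw [hb.potential_quadOp hx, hb.potential_quadOp hy] at key
  linarith

end BalancedRates

/-! ### Ratio dynamics and the stable set -/

/-- The induced map of the ratio `x₂ / x₁`. -/
noncomputable def ratioMap (θ₁ θ₂ u : ℝ) : ℝ := θ₂ / θ₁ * u * (u + 2) / (1 + 2 * u)

/-- The ratio of the coordinates of the positive fixed point. -/
noncomputable def fixedRatio (θ₁ θ₂ : ℝ) : ℝ := (2 * θ₂ - θ₁) / (2 * θ₁ - θ₂)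

/-- The zero level of the escape rate. -/
def zeroLevel (θ₁ θ₂ : ℝ) : Set (Fin 2 → ℝ) := {x | 0 < x ∧ potential θ₁ θ₂ x = 0}

/-- The preimage of a closed set is the first projection of a compact slice of the graph. -/
theorem continuousOn_of_isCompact_graph {γ : ℝ → ℝ} {s : Set ℝ}
    (h : IsCompact ((fun t => (![t, γ t] : Fin 2 → ℝ)) '' s)) : ContinuousOn γ s := by
  rw [continuousOn_iff_isClosed]
  intro t ht
  refine ⟨(fun x : Fin 2 → ℝ => x 0) '' ((fun t => (![t, γ t] : Fin 2 → ℝ)) '' s ∩ {x | x 1 ∈ t}),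
    ((h.inter_right (ht.preimage (continuous_apply 1))).image (continuous_apply 0)).isClosed, ?_⟩
  ext a
  constructor
  · rintro ⟨ha, has⟩
    exact ⟨⟨_, ⟨⟨a, has, rfl⟩, by simpa using ha⟩, by simp⟩, has⟩
  · rintro ⟨⟨x, ⟨⟨b, hb, rfl⟩, hx⟩, rfl⟩, has⟩
    exact ⟨by simpa using hx, has⟩

theorem pair_pos {s t : ℝ} (hs : 0 < s) (ht : 0 ≤ t) : (0 : Fin 2 → ℝ) < ![s, t] :=
  pi_two_pos.2 ⟨hs.le, ht, add_pos_of_pos_of_nonneg hs ht⟩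

theorem pair_pos' {s t : ℝ} (hs : 0 ≤ s) (ht : 0 < t) : (0 : Fin 2 → ℝ) < ![s, t] :=
  pi_two_pos.2 ⟨hs, ht.le, add_pos_of_nonneg_of_pos hs ht⟩

theorem pair_le {s t s' t' : ℝ} (hs : s ≤ s') (ht : t ≤ t') :
    (![s, t] : Fin 2 → ℝ) ≤ ![s', t'] := by
  rw [Pi.le_def, Fin.forall_fin_two]
  exact ⟨hs, ht⟩

namespace BalancedRates

variable {θ₁ θ₂ : ℝ} (hb : BalancedRates θ₁ θ₂)
include hb

theorem sub_pos₁ : 0 < 2 * θ₂ - θ₁ := sub_pos.2 hb.lt₁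

theorem sub_pos₂ : 0 < 2 * θ₁ - θ₂ := sub_pos.2 hb.lt₂

theorem fixedRatio_pos : 0 < fixedRatio θ₁ θ₂ := div_pos hb.sub_pos₁ hb.sub_pos₂

theorem posFixedPoint_zero_pos : 0 < posFixedPoint θ₁ θ₂ 0 := by
  have := hb.pos₁
  have := hb.pos₂
  have := hb.sub_pos₂
  simp only [posFixedPoint, Matrix.cons_val_zero]
  exact div_pos (by linarith) (by positivity)

theorem posFixedPoint_eq :
    posFixedPoint θ₁ θ₂ = posFixedPoint θ₁ θ₂ 0 • ![1, fixedRatio θ₁ θ₂] := by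
  have h1 := hb.pos₁.ne'
  have h2 := hb.pos₂.ne'
  have h3 := hb.sub_pos₂.ne'
  ext i
  fin_cases i
  · simp
  · simp [posFixedPoint, fixedRatio]
    field_simp
    ring

theorem posFixedPoint_one :
    posFixedPoint θ₁ θ₂ 1 = posFixedPoint θ₁ θ₂ 0 * fixedRatio θ₁ θ₂ := by
  simpa using congrFun hb.posFixedPoint_eq 1

theorem posFixedPoint_one_pos : 0 < posFixedPoint θ₁ θ₂ 1 := by
  rw [hb.posFixedPoint_one]
  exact mul_pos hb.posFixedPoint_zero_pos hb.fixedRatio_pos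

theorem posFixedPoint_pos : 0 < posFixedPoint θ₁ θ₂ := by
  rw [← pi_two_eta (posFixedPoint θ₁ θ₂)]
  exact pair_pos hb.posFixedPoint_zero_pos hb.posFixedPoint_one_pos.le

theorem quadOp_posFixedPoint : quadOp ![θ₁, θ₂] (posFixedPoint θ₁ θ₂) = posFixedPoint θ₁ θ₂ := by
  have h1 := hb.pos₁.ne'
  have h2 := hb.pos₂.ne'
  rw [quadOp_two]
  ext i
  fin_cases i
  · simp [posFixedPoint]
    field_simp
    ring
  · simp [posFixedPoint]
    field_simp
    ring

theorem potential_posFixedPoint : potential θ₁ θ₂ (posFixedPoint θ₁ θ₂) = 0 :=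
  hb.potential_eq_zero_of_fixed hb.posFixedPoint_pos hb.quadOp_posFixedPoint

theorem ratioMap_sub {u : ℝ} (hu : 0 < u) :
    ratioMap θ₁ θ₂ u - fixedRatio θ₁ θ₂ =
      (1 + θ₂ / θ₁ * u) / (1 + 2 * u) * (u - fixedRatio θ₁ θ₂) := by
  have h1 := hb.pos₁.ne'
  have h3 := hb.sub_pos₂.ne'
  have h4 : 1 + 2 * u ≠ 0 := by positivity
  rw [ratioMap, fixedRatio, div_sub_div _ _ h4 h3, sub_div' h3, div_mul_div_comm]
  congr 1
  field_simp
  ring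

theorem rate_lt_two : θ₂ / θ₁ < 2 := by
  rw [div_lt_iff₀ hb.pos₁]
  exact hb.lt₂

theorem rate_pos : 0 < θ₂ / θ₁ := div_pos hb.pos₂ hb.pos₁

/-- The factor in `ratioMap_sub` decreases in u because θ₂/θ₁ < 2. It tends to 1 as u → 0, so
uniform contraction needs a positive lower bound δ. -/
theorem abs_ratioMap_sub_le {δ u : ℝ} (hδ : 0 < δ) (hu : δ ≤ u) :
    |ratioMap θ₁ θ₂ u - fixedRatio θ₁ θ₂| ≤
      (1 + θ₂ / θ₁ * δ) / (1 + 2 * δ) * |u - fixedRatio θ₁ θ₂| := by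
  have hu0 : 0 < u := hδ.trans_le hu
  have hr := hb.rate_pos
  rw [hb.ratioMap_sub hu0, abs_mul, abs_of_pos (by positivity)]
  gcongr ?_ * _
  rw [div_le_div_iff₀ (by positivity) (by positivity)]
  nlinarith [mul_nonneg (sub_pos.2 hb.rate_lt_two).le (sub_nonneg.2 hu)]

theorem contraction_lt_one {δ : ℝ} (hδ : 0 < δ) : (1 + θ₂ / θ₁ * δ) / (1 + 2 * δ) < 1 := by
  rw [div_lt_one (by positivity)]
  gcongr
  exact hb.rate_lt_two

theorem abs_ratioMap_sub_le_self {u : ℝ} (hu : 0 < u) :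
    |ratioMap θ₁ θ₂ u - fixedRatio θ₁ θ₂| ≤ |u - fixedRatio θ₁ θ₂| :=
  (hb.abs_ratioMap_sub_le hu le_rfl).trans
    (mul_le_of_le_one_left (abs_nonneg _) (hb.contraction_lt_one hu).le)

theorem le_ratioMap {δ u : ℝ} (hδ : 0 < δ) (hδ' : δ ≤ fixedRatio θ₁ θ₂) (hu : δ ≤ u) :
    δ ≤ ratioMap θ₁ θ₂ u := by
  have hu0 : 0 < u := hδ.trans_le hu
  have hr := hb.rate_pos
  have h := hb.ratioMap_sub hu0
  have hc : 0 < (1 + θ₂ / θ₁ * u) / (1 + 2 * u) := by positivity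
  have hc1 := hb.contraction_lt_one hu0
  rcases le_total (fixedRatio θ₁ θ₂) u with hle | hle
  · nlinarith [mul_nonneg hc.le (sub_nonneg.2 hle)]
  · nlinarith [mul_nonneg (sub_pos.2 hc1).le (sub_nonneg.2 hle)]

theorem quadOp_coord_pos {x : Fin 2 → ℝ} (h0 : 0 < x 0) (h1 : 0 < x 1) :
    0 < quadOp ![θ₁, θ₂] x 0 ∧ 0 < quadOp ![θ₁, θ₂] x 1 := by
  have := hb.pos₁
  have := hb.pos₂
  rw [quadOp_two_zero, quadOp_two_one]
  constructor <;> positivity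

theorem ratio_quadOp {x : Fin 2 → ℝ} (h0 : 0 < x 0) (h1 : 0 < x 1) :
    quadOp ![θ₁, θ₂] x 1 / quadOp ![θ₁, θ₂] x 0 = ratioMap θ₁ θ₂ (x 1 / x 0) := by
  have := hb.pos₁
  rw [quadOp_two_zero, quadOp_two_one, ratioMap]
  field_simp

theorem iterate_coord_pos {x : Fin 2 → ℝ} (h0 : 0 < x 0) (h1 : 0 < x 1) (m : ℕ) :
    0 < (quadOp ![θ₁, θ₂])^[m] x 0 ∧ 0 < (quadOp ![θ₁, θ₂])^[m] x 1 := by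
  induction m with
  | zero => exact ⟨h0, h1⟩
  | succ m ih =>
    rw [Function.iterate_succ_apply']
    exact hb.quadOp_coord_pos ih.1 ih.2

theorem tendsto_ratio {x : Fin 2 → ℝ} (h0 : 0 < x 0) (h1 : 0 < x 1) :
    Tendsto (fun m : ℕ => (quadOp ![θ₁, θ₂])^[m] x 1 / (quadOp ![θ₁, θ₂])^[m] x 0) atTop
      (𝓝 (fixedRatio θ₁ θ₂)) := by
  -- Ratios approach the fixed one without crossing it, so the whole orbit stays above this bound.
  set δ := min (x 1 / x 0) (fixedRatio θ₁ θ₂) with hδ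
  have hδ0 : 0 < δ := lt_min (div_pos h1 h0) hb.fixedRatio_pos
  set κ := (1 + θ₂ / θ₁ * δ) / (1 + 2 * δ) with hκ
  have hr := hb.rate_pos
  have hκ0 : 0 ≤ κ := by positivity
  have key : ∀ m : ℕ, δ ≤ (quadOp ![θ₁, θ₂])^[m] x 1 / (quadOp ![θ₁, θ₂])^[m] x 0 ∧
      |(quadOp ![θ₁, θ₂])^[m] x 1 / (quadOp ![θ₁, θ₂])^[m] x 0 - fixedRatio θ₁ θ₂| ≤
        κ ^ m * |x 1 / x 0 - fixedRatio θ₁ θ₂| := by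
    intro m
    induction m with
    | zero => exact ⟨min_le_left _ _, by simp⟩
    | succ m ih =>
      have hm := hb.iterate_coord_pos h0 h1 m
      rw [Function.iterate_succ_apply', hb.ratio_quadOp hm.1 hm.2]
      refine ⟨hb.le_ratioMap hδ0 (min_le_right _ _) ih.1,
        (hb.abs_ratioMap_sub_le hδ0 ih.1).trans ?_⟩
      rw [pow_succ', mul_assoc]
      exact mul_le_mul_of_nonneg_left ih.2 hκ0
  rw [tendsto_iff_dist_tendsto_zero]
  refine squeeze_zero (fun _ => dist_nonneg) (fun m => (key m).2) ?_
  simpa using (tendsto_pow_atTop_nhds_zero_of_lt_one hκ0 (hb.contraction_lt_one hδ0)).mul_const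
    |x 1 / x 0 - fixedRatio θ₁ θ₂|

theorem potential_eq_log_add {x : Fin 2 → ℝ} (h0 : 0 < x 0) (h1 : 0 ≤ x 1) :
    potential θ₁ θ₂ x = Real.log (x 0) + potential θ₁ θ₂ ![1, x 1 / x 0] := by
  rw [← hb.potential_smul (pair_pos one_pos (by positivity)) h0]
  congr 1
  ext i
  fin_cases i
  · simp
  · simp [mul_div_cancel₀ _ h0.ne']

/-- By homogeneity each ray meets the zero level once, so convergence of ratios there becomes
convergence of points. -/
theorem eq_exp_smul {x : Fin 2 → ℝ} (h0 : 0 < x 0) (h1 : 0 ≤ x 1)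
    (hx : potential θ₁ θ₂ x = 0) :
    x = Real.exp (-potential θ₁ θ₂ ![1, x 1 / x 0]) • ![1, x 1 / x 0] := by
  have h := hb.potential_eq_log_add h0 h1
  have he : Real.exp (-potential θ₁ θ₂ ![1, x 1 / x 0]) = x 0 := by
    rw [← Real.exp_log h0]
    congr 1
    rw [Real.exp_log h0]
    linarith
  rw [he]
  ext i
  fin_cases i
  · simp
  · simp [mul_div_cancel₀ _ h0.ne']

theorem continuousAt_potential {x : Fin 2 → ℝ} (h0 : 0 < x 0) (h1 : 0 < x 1) :
    ContinuousAt (potential θ₁ θ₂) x := by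
  refine hb.continuousOn_potential.continuousAt ?_
  filter_upwards [(continuous_apply 0).continuousAt.eventually_const_lt h0,
    (continuous_apply 1).continuousAt.eventually_const_lt h1] with y hy0 hy1
  exact pi_two_pos.2 ⟨hy0.le, hy1.le, add_pos hy0 hy1⟩

omit hb in
theorem continuous_pair_one : Continuous fun u : ℝ => (![1, u] : Fin 2 → ℝ) := by
  refine continuous_pi fun i => ?_
  fin_cases i <;> simp <;> fun_prop

theorem continuousAt_profile {u : ℝ} (hu : 0 < u) :
    ContinuousAt (fun u => potential θ₁ θ₂ ![1, u]) u :=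
  ContinuousAt.comp (hb.continuousAt_potential (by simp) (by simpa using hu))
    continuous_pair_one.continuousAt

theorem tendsto_of_potential_eq_zero {x : Fin 2 → ℝ} (h0 : 0 < x 0) (h1 : 0 < x 1)
    (hx : potential θ₁ θ₂ x = 0) :
    Tendsto (fun m : ℕ => (quadOp ![θ₁, θ₂])^[m] x) atTop (𝓝 (posFixedPoint θ₁ θ₂)) := by
  have hxpos : 0 < x := pi_two_pos.2 ⟨h0.le, h1.le, add_pos h0 h1⟩
  have hE := hb.eq_exp_smul hb.posFixedPoint_zero_pos hb.posFixedPoint_one_pos.le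
    hb.potential_posFixedPoint
  have hr : posFixedPoint θ₁ θ₂ 1 / posFixedPoint θ₁ θ₂ 0 = fixedRatio θ₁ θ₂ := by
    rw [hb.posFixedPoint_one, mul_div_cancel_left₀ _ hb.posFixedPoint_zero_pos.ne']
  rw [hr] at hE
  rw [hE]
  have hc : ContinuousAt (fun u : ℝ => Real.exp (-potential θ₁ θ₂ ![1, u]) • (![1, u] : Fin 2 → ℝ))
      (fixedRatio θ₁ θ₂) :=
    (hb.continuousAt_profile hb.fixedRatio_pos).neg.rexp.smul continuous_pair_one.continuousAt
  refine (hc.tendsto.comp (hb.tendsto_ratio h0 h1)).congr fun m => ?_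
  have hm := hb.iterate_coord_pos h0 h1 m
  exact (hb.eq_exp_smul hm.1 hm.2.le (by rw [hb.potential_iterate hxpos, hx, mul_zero])).symm

theorem mem_stableSet_iff {x : Fin 2 → ℝ} :
    x ∈ stableSet (quadOp ![θ₁, θ₂]) (posFixedPoint θ₁ θ₂) ↔
      0 < x 0 ∧ 0 < x 1 ∧ potential θ₁ θ₂ x = 0 := by
  constructor
  · rintro ⟨hx, ht⟩
    obtain ⟨h0, h1⟩ := pi_two_nonneg.1 hx
    have h0' : x 0 ≠ 0 := by
      intro h
      have hz : ∀ m : ℕ, (quadOp ![θ₁, θ₂])^[m] x 0 = 0 := by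
        intro m
        induction m with
        | zero => exact h
        | succ m ih => rw [Function.iterate_succ_apply', quadOp_two_zero, ih]; simp
      have := (tendsto_pi_nhds.1 ht 0)
      simp only [hz] at this
      exact hb.posFixedPoint_zero_pos.ne (tendsto_nhds_unique tendsto_const_nhds this)
    have h1' : x 1 ≠ 0 := by
      intro h
      have hz : ∀ m : ℕ, (quadOp ![θ₁, θ₂])^[m] x 1 = 0 := by
        intro m
        induction m with
        | zero => exact h
        | succ m ih => rw [Function.iterate_succ_apply', quadOp_two_one, ih]; simp
      have := (tendsto_pi_nhds.1 ht 1)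
      simp only [hz] at this
      exact hb.posFixedPoint_one_pos.ne (tendsto_nhds_unique tendsto_const_nhds this)
    have h0 := h0.lt_of_ne' h0'
    have h1 := h1.lt_of_ne' h1'
    have hxpos : 0 < x := pi_two_pos.2 ⟨h0.le, h1.le, add_pos h0 h1⟩
    refine ⟨h0, h1, ?_⟩
    have hlim := (hb.continuousAt_potential hb.posFixedPoint_zero_pos
      hb.posFixedPoint_one_pos).tendsto.comp ht
    rw [hb.potential_posFixedPoint] at hlim
    have habs := hlim.abs
    rw [abs_zero] at habs
    -- The potentials along the orbit tend to 0, yet their absolute values never fall below the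
    -- initial one.
    refine abs_nonpos_iff.1 (ge_of_tendsto' habs fun m => ?_)
    rw [Function.comp_apply, hb.potential_iterate hxpos, abs_mul]
    refine le_mul_of_one_le_left (abs_nonneg _) ?_
    rw [abs_of_pos (by positivity)]
    exact one_le_pow₀ one_le_two
  · rintro ⟨h0, h1, hx⟩
    exact ⟨pi_two_nonneg.2 ⟨h0.le, h1.le⟩, hb.tendsto_of_potential_eq_zero h0 h1 hx⟩

/-! ### The zero level as a compact graph -/

theorem potential_fst_axis {s : ℝ} (hs : 0 < s) :
    potential θ₁ θ₂ ![s, 0] = Real.log (θ₁ * s / 2) := by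
  have h1 := hb.pos₁
  have hp : (0 : Fin 2 → ℝ) < ![2 / θ₁, 0] := pair_pos (by positivity) le_rfl
  have hfix : quadOp ![θ₁, θ₂] ![2 / θ₁, 0] = ![2 / θ₁, 0] := by
    rw [quadOp_two]
    ext i
    fin_cases i <;> simp
    field_simp
  have h := hb.potential_smul hp (t := θ₁ * s / 2) (by positivity)
  rw [hb.potential_eq_zero_of_fixed hp hfix, add_zero] at h
  rw [← h]
  congr 1
  ext i
  fin_cases i <;> simp
  field_simp

theorem potential_snd_axis {t : ℝ} (ht : 0 < t) :
    potential θ₁ θ₂ ![0, t] = Real.log (θ₂ * t / 2) := by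
  have h1 := hb.pos₂
  have hp : (0 : Fin 2 → ℝ) < ![0, 2 / θ₂] := pair_pos' le_rfl (by positivity)
  have hfix : quadOp ![θ₁, θ₂] ![0, 2 / θ₂] = ![0, 2 / θ₂] := by
    rw [quadOp_two]
    ext i
    fin_cases i <;> simp
    field_simp
  have h := hb.potential_smul hp (t := θ₂ * t / 2) (by positivity)
  rw [hb.potential_eq_zero_of_fixed hp hfix, add_zero] at h
  rw [← h]
  congr 1
  ext i
  fin_cases i <;> simp
  field_simp

theorem fst_le_of_mem_zeroLevel {x : Fin 2 → ℝ} (hx : x ∈ zeroLevel θ₁ θ₂) : x 0 ≤ 2 / θ₁ := by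
  obtain ⟨hp, hz⟩ := hx
  obtain ⟨h0, h1, -⟩ := pi_two_pos.1 hp
  by_contra! hlt
  have ht := hb.pos₁
  have h0' : 0 < x 0 := (by positivity : 0 < 2 / θ₁).trans hlt
  have h2 := hb.potential_mono (pair_pos h0' le_rfl) (pair_le le_rfl h1 : ![x 0, 0] ≤ ![x 0, x 1])
  rw [pi_two_eta, hz, hb.potential_fst_axis h0'] at h2
  rw [div_lt_iff₀ ht] at hlt
  linarith [Real.log_pos (by linarith : 1 < θ₁ * x 0 / 2)]

theorem fst_lt_of_mem_zeroLevel {x : Fin 2 → ℝ} (hx : x ∈ zeroLevel θ₁ θ₂) (h1 : 0 < x 1) :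
    x 0 < 2 / θ₁ := by
  refine (hb.fst_le_of_mem_zeroLevel hx).lt_of_ne fun h => ?_
  have ht := hb.pos₁
  have h0' : 0 < x 0 := by rw [h]; positivity
  have h2 := hb.potential_strictMono_snd h0' le_rfl h1
  rw [pi_two_eta, hx.2, hb.potential_fst_axis h0', h,
    show θ₁ * (2 / θ₁) / 2 = 1 by field_simp, Real.log_one] at h2
  exact lt_irrefl _ h2

theorem snd_eq_of_mem_zeroLevel {s t t' : ℝ} (h : ![s, t] ∈ zeroLevel θ₁ θ₂)
    (h' : ![s, t'] ∈ zeroLevel θ₁ θ₂) : t = t' := by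
  obtain ⟨hp, hz⟩ := h
  obtain ⟨hp', hz'⟩ := h'
  obtain ⟨h0, h1, h2⟩ := pi_two_pos.1 hp
  obtain ⟨-, h1', h2'⟩ := pi_two_pos.1 hp'
  simp only [Matrix.cons_val_zero, Matrix.cons_val_one] at h0 h1 h2 h1' h2'
  have ht := hb.pos₂
  rcases h0.lt_or_eq with hs | rfl
  · rcases lt_trichotomy t t' with hlt | heq | hlt
    · linarith [hb.potential_strictMono_snd hs h1 hlt]
    · exact heq
    · linarith [hb.potential_strictMono_snd hs h1' hlt]
  · rw [zero_add] at h2 h2'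
    rw [hb.potential_snd_axis h2] at hz
    rw [hb.potential_snd_axis h2'] at hz'
    have e := Real.log_injOn_pos (by simp; positivity) (by simp; positivity) (hz.trans hz'.symm)
    have e' : θ₂ * t = θ₂ * t' := by linarith
    exact mul_left_cancel₀ ht.ne' e'

theorem exists_mem_zeroLevel {s : ℝ} (hs : s ∈ Icc 0 (2 / θ₁)) :
    ∃ t, ![s, t] ∈ zeroLevel θ₁ θ₂ := by
  have ht₁ := hb.pos₁
  have ht₂ := hb.pos₂
  have hp : (0 : Fin 2 → ℝ) < ![0, 2 / θ₂] := pair_pos' le_rfl (by positivity)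
  have hE : potential θ₁ θ₂ ![0, 2 / θ₂] = 0 := by
    rw [hb.potential_snd_axis (by positivity), show θ₂ * (2 / θ₂) / 2 = 1 by field_simp,
      Real.log_one]
  rcases hs.1.lt_or_eq with h0 | rfl
  · have hc : ContinuousOn (fun t => potential θ₁ θ₂ ![s, t]) (Icc 0 (2 / θ₂)) := by
      refine hb.continuousOn_potential.comp (Continuous.continuousOn ?_) fun t ht =>
        pair_pos h0 ht.1
      refine continuous_pi fun i => ?_
      fin_cases i <;> simp <;> fun_prop
    have hlow : potential θ₁ θ₂ ![s, 0] ≤ 0 := by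
      rw [hb.potential_fst_axis h0]
      have := hs.2
      rw [le_div_iff₀ ht₁] at this
      exact Real.log_nonpos (by positivity) (by linarith)
    have hhigh : 0 ≤ potential θ₁ θ₂ ![s, 2 / θ₂] :=
      hE.symm.le.trans (hb.potential_mono hp (pair_le h0.le le_rfl))
    obtain ⟨t, ht, hz⟩ := intermediate_value_Icc (by positivity) hc ⟨hlow, hhigh⟩
    exact ⟨t, pair_pos h0 ht.1, hz⟩
  · exact ⟨2 / θ₂, hp, hE⟩

/-- Zero potential and a correction of size at most log 3 confine the weight to [1/3, 3]: the upper
bound gives boundedness, and the lower one keeps away from the origin, where continuity is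
unavailable. -/
theorem isCompact_zeroLevel : IsCompact (zeroLevel θ₁ θ₂) := by
  have ht₁ := hb.pos₁
  have ht₂ := hb.pos₂
  set B : Set (Fin 2 → ℝ) := {x | 0 ≤ x} ∩ {x | 1 / 3 ≤ weight θ₁ θ₂ x} ∩
    {x | weight θ₁ θ₂ x ≤ 3} with hB
  have hBc : IsClosed B :=
    (isClosed_Ici.inter (isClosed_le continuous_const (continuous_weight θ₁ θ₂))).inter
      (isClosed_le (continuous_weight θ₁ θ₂) continuous_const)
  have hBs : B ⊆ Icc 0 ![6 / θ₁, 6 / θ₂] := by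
    rintro x ⟨⟨h0, -⟩, h3⟩
    refine ⟨h0, ?_⟩
    obtain ⟨h0, h1⟩ := pi_two_nonneg.1 h0
    have h3 : (θ₁ * x 0 + θ₂ * x 1) / 2 ≤ 3 := h3
    have := mul_nonneg ht₁.le h0
    have := mul_nonneg ht₂.le h1
    rw [← pi_two_eta x]
    refine pair_le ?_ ?_ <;> rw [le_div_iff₀ (by assumption)] <;> linarith
  have hBp : B ⊆ Ioi 0 := by
    rintro x ⟨⟨h0, h3⟩, -⟩
    refine lt_of_le_of_ne (show 0 ≤ x from h0) fun h => ?_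
    have h3 : 1 / 3 ≤ (θ₁ * x 0 + θ₂ * x 1) / 2 := h3
    rw [← h] at h3
    norm_num at h3
  have hZ : zeroLevel θ₁ θ₂ = B ∩ potential θ₁ θ₂ ⁻¹' {0} := by
    ext x
    constructor
    · rintro ⟨hp, hz⟩
      have hw := hb.weight_pos hp
      have hc := abs_le.1 (hb.abs_correction_le hp)
      have hz' : Real.log (weight θ₁ θ₂ x) + correction θ₁ θ₂ x = 0 := hz
      refine ⟨⟨⟨hp.le, ?_⟩, ?_⟩, hz⟩
      · refine (Real.log_le_log_iff (by norm_num) hw).1 ?_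
        rw [one_div, Real.log_inv]
        linarith
      · refine (Real.log_le_log_iff hw (by norm_num)).1 ?_
        linarith
    · rintro ⟨hxB, hz⟩
      exact ⟨hBp hxB, hz⟩
  rw [hZ]
  exact isCompact_Icc.of_isClosed_subset
    ((hb.continuousOn_potential.mono hBp).preimage_isClosed_of_isClosed hBc isClosed_singleton)
    (inter_subset_left.trans hBs)

theorem quadOp_mem_zeroLevel {x : Fin 2 → ℝ} (hx : x ∈ zeroLevel θ₁ θ₂) :
    quadOp ![θ₁, θ₂] x ∈ zeroLevel θ₁ θ₂ :=
  ⟨hb.quadOp_pos hx.1, by rw [hb.potential_quadOp hx.1, hx.2, mul_zero]⟩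

theorem exists_isStableCurve : ∃ γ : ℝ → ℝ, IsStableCurve θ₁ θ₂ γ := by
  have ht₁ := hb.pos₁
  have ht₂ := hb.pos₂
  have hex : ∀ s, ∃ t, s ∈ Icc 0 (2 / θ₁) → ![s, t] ∈ zeroLevel θ₁ θ₂ := by
    intro s
    by_cases hs : s ∈ Icc 0 (2 / θ₁)
    · obtain ⟨t, ht⟩ := hb.exists_mem_zeroLevel hs
      exact ⟨t, fun _ => ht⟩
    -- Off the interval the value is arbitrary.
    · exact ⟨0, fun h => absurd h hs⟩
  choose γ hγ using hex
  have hval : ∀ x ∈ zeroLevel θ₁ θ₂, x 0 ∈ Icc 0 (2 / θ₁) ∧ ![x 0, γ (x 0)] = x := by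
    intro x hx
    have hs : x 0 ∈ Icc 0 (2 / θ₁) :=
      ⟨(pi_two_pos.1 hx.1).1, hb.fst_le_of_mem_zeroLevel hx⟩
    have : γ (x 0) = x 1 := hb.snd_eq_of_mem_zeroLevel (hγ _ hs) (by rwa [pi_two_eta])
    exact ⟨hs, by rw [this, pi_two_eta]⟩
  have himg : (fun s => (![s, γ s] : Fin 2 → ℝ)) '' Icc 0 (2 / θ₁) = zeroLevel θ₁ θ₂ := by
    ext x
    constructor
    · rintro ⟨s, hs, rfl⟩
      exact hγ s hs
    · intro hx
      exact ⟨x 0, hval x hx⟩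
  have hthrough : ∀ s t, ![s, t] ∈ zeroLevel θ₁ θ₂ → γ s = t := fun s t h => by
    simpa using congrFun (hval _ h).2 1
  refine ⟨γ, ?_, ?_, ?_, ?_, ?_, ?_⟩
  · exact continuousOn_of_isCompact_graph (by rw [himg]; exact hb.isCompact_zeroLevel)
  · refine hthrough _ _ ⟨pair_pos (by positivity) le_rfl, ?_⟩
    rw [hb.potential_fst_axis (by positivity), show θ₁ * (2 / θ₁) / 2 = 1 by field_simp,
      Real.log_one]
  · refine hthrough _ _ ⟨pair_pos' le_rfl (by positivity), ?_⟩
    rw [hb.potential_snd_axis (by positivity), show θ₂ * (2 / θ₂) / 2 = 1 by field_simp,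
      Real.log_one]
  · refine hthrough _ _ ?_
    rw [pi_two_eta]
    exact ⟨hb.posFixedPoint_pos, hb.potential_posFixedPoint⟩
  · rw [himg]
    exact fun x hx => hb.quadOp_mem_zeroLevel hx
  · ext x
    rw [hb.mem_stableSet_iff]
    constructor
    · rintro ⟨s, hs, rfl⟩
      have hz := hγ s (Ioo_subset_Icc_self hs)
      refine ⟨hs.1, ?_, hz.2⟩
      refine lt_of_le_of_ne (pi_two_pos.1 hz.1).2.1 fun h => ?_
      have h : 0 = γ s := h
      have h2 := hz.2
      rw [← h, hb.potential_fst_axis hs.1] at h2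
      have h3 := hs.2
      have h4 := hs.1
      rw [lt_div_iff₀ ht₁] at h3
      exact (Real.log_neg (by positivity) (by linarith : θ₁ * s / 2 < 1)).ne h2
    · rintro ⟨h0, h1, hz⟩
      have hx : x ∈ zeroLevel θ₁ θ₂ := ⟨pi_two_pos.2 ⟨h0.le, h1.le, add_pos h0 h1⟩, hz⟩
      exact ⟨x 0, ⟨h0, hb.fst_lt_of_mem_zeroLevel hx h1⟩, (hval x hx).2⟩

end BalancedRates

/-! ### Differentiability of the profile and the tangent -/

/-- The derivative at the fixed ratio of the induced map of the ratio. -/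
noncomputable def ratioMultiplier (θ₁ θ₂ : ℝ) : ℝ :=
  (1 + θ₂ / θ₁ * fixedRatio θ₁ θ₂) / (1 + 2 * fixedRatio θ₁ θ₂)

/-- The slope at the fixed ratio of `u ↦ potential (1, u)`. -/
noncomputable def profileSlope (θ₁ θ₂ : ℝ) : ℝ :=
  2 / (1 + 2 * fixedRatio θ₁ θ₂) / (2 - ratioMultiplier θ₁ θ₂)

namespace BalancedRates

variable {θ₁ θ₂ : ℝ} (hb : BalancedRates θ₁ θ₂)
include hb

theorem ratioMap_fixedRatio : ratioMap θ₁ θ₂ (fixedRatio θ₁ θ₂) = fixedRatio θ₁ θ₂ := by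
  have := hb.ratioMap_sub hb.fixedRatio_pos
  rw [sub_self, mul_zero] at this
  linarith

theorem hasDerivAt_ratioMap :
    HasDerivAt (ratioMap θ₁ θ₂) (ratioMultiplier θ₁ θ₂) (fixedRatio θ₁ θ₂) := by
  have hu := hb.fixedRatio_pos
  have hc : DifferentiableAt ℝ (fun u : ℝ => (1 + θ₂ / θ₁ * u) / (1 + 2 * u))
      (fixedRatio θ₁ θ₂) := by
    refine DifferentiableAt.div (by fun_prop) (by fun_prop) (by positivity)
  have h := (hc.hasDerivAt.mul ((hasDerivAt_id (fixedRatio θ₁ θ₂)).sub_const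
    (fixedRatio θ₁ θ₂))).add_const (fixedRatio θ₁ θ₂)
  simp only [id, sub_self, mul_zero, mul_one, zero_add] at h
  refine h.congr_of_eventuallyEq ?_
  filter_upwards [lt_mem_nhds hu] with u hu
  have := hb.ratioMap_sub hu
  simp only [Pi.mul_apply]
  linarith

theorem two_mul_profile {u : ℝ} (hu : 0 < u) :
    2 * potential θ₁ θ₂ ![1, u] =
      Real.log (θ₁ / 2 * (1 + 2 * u)) + potential θ₁ θ₂ ![1, ratioMap θ₁ θ₂ u] := by
  have h0 : (0 : ℝ) < (![1, u] : Fin 2 → ℝ) 0 := by simp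
  have h1 : (0 : ℝ) < (![1, u] : Fin 2 → ℝ) 1 := by simpa using hu
  have h := hb.quadOp_coord_pos h0 h1
  rw [← hb.potential_quadOp (pair_pos one_pos hu.le), hb.potential_eq_log_add h.1 h.2.le,
    hb.ratio_quadOp h0 h1, quadOp_two_zero]
  simp

/-- Since (1, a) ≤ (1, b) ≤ (b/a)(1, a), monotonicity and homogeneity bound the increment by
log(b/a) ≤ b/a - 1. -/
theorem profile_sub_le {a b : ℝ} (ha : 0 < a) (hab : a ≤ b) :
    |potential θ₁ θ₂ ![1, b] - potential θ₁ θ₂ ![1, a]| ≤ (b - a) / a := by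
  have hpa := pair_pos one_pos ha.le
  have hpb := pair_pos one_pos (ha.le.trans hab)
  have hba : 0 < b / a := div_pos (ha.trans_le hab) ha
  have h1 := hb.potential_mono hpa (pair_le le_rfl hab)
  have h2 : potential θ₁ θ₂ ![1, b] ≤ potential θ₁ θ₂ ((b / a) • ![1, a]) := by
    refine hb.potential_mono hpb ?_
    rw [Pi.le_def, Fin.forall_fin_two]
    simp only [Pi.smul_apply, Matrix.cons_val_zero, Matrix.cons_val_one, smul_eq_mul, mul_one]
    exact ⟨(one_le_div ha).2 hab, (div_mul_cancel₀ b ha.ne').ge⟩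
  rw [hb.potential_smul hpa hba] at h2
  have h3 := Real.log_le_sub_one_of_pos hba
  rw [abs_of_nonneg (sub_nonneg.2 h1), sub_div, div_self ha.ne']
  linarith

theorem abs_profile_sub_le {u : ℝ} (hu : |u - fixedRatio θ₁ θ₂| < fixedRatio θ₁ θ₂ / 2) :
    |potential θ₁ θ₂ ![1, u] - potential θ₁ θ₂ ![1, fixedRatio θ₁ θ₂]| ≤
      2 / fixedRatio θ₁ θ₂ * |u - fixedRatio θ₁ θ₂| := by
  have hp := hb.fixedRatio_pos
  obtain ⟨h1, h2⟩ := abs_lt.1 hu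
  have hu0 : fixedRatio θ₁ θ₂ / 2 < u := by linarith
  rcases le_total (fixedRatio θ₁ θ₂) u with h | h
  · refine (hb.profile_sub_le hp h).trans ?_
    have h0 := sub_nonneg.2 h
    rw [abs_of_nonneg h0, div_mul_eq_mul_div]
    gcongr
    linarith
  · rw [abs_sub_comm, abs_sub_comm u]
    refine (hb.profile_sub_le (by linarith) h).trans ?_
    have h0 := sub_nonneg.2 h
    rw [abs_of_nonneg h0]
    calc (fixedRatio θ₁ θ₂ - u) / u ≤ (fixedRatio θ₁ θ₂ - u) / (fixedRatio θ₁ θ₂ / 2) := by gcongr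
      _ = _ := by field_simp

theorem ratioMultiplier_lt_one : ratioMultiplier θ₁ θ₂ < 1 :=
  hb.contraction_lt_one hb.fixedRatio_pos

theorem profileSlope_pos : 0 < profileSlope θ₁ θ₂ := by
  have := hb.fixedRatio_pos
  have := hb.ratioMultiplier_lt_one
  exact div_pos (by positivity) (by linarith)

/-- The slope d is chosen to solve the formally differentiated functional equation 2d = 2/(1 + 2p) +
λd, with λ the multiplier of the ratio map; this is why the derivative vanishes. -/
theorem hasDerivAt_defect :
    HasDerivAt (fun u => Real.log (θ₁ / 2 * (1 + 2 * u)) - 2 * profileSlope θ₁ θ₂ * u +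
      profileSlope θ₁ θ₂ * ratioMap θ₁ θ₂ u) 0 (fixedRatio θ₁ θ₂) := by
  have hp := hb.fixedRatio_pos
  have ht := hb.pos₁
  have h1 : HasDerivAt (fun u : ℝ => θ₁ / 2 * (1 + 2 * u)) (θ₁ / 2 * (2 * 1)) (fixedRatio θ₁ θ₂) :=
    (((hasDerivAt_id _).const_mul 2).const_add 1).const_mul _
  have h2 := ((h1.log (by positivity)).sub ((hasDerivAt_id _).const_mul
    (2 * profileSlope θ₁ θ₂))).add (hb.hasDerivAt_ratioMap.const_mul (profileSlope θ₁ θ₂))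
  refine h2.congr_deriv ?_
  have h3 : profileSlope θ₁ θ₂ * (2 - ratioMultiplier θ₁ θ₂) =
      2 / (1 + 2 * fixedRatio θ₁ θ₂) :=
    div_mul_cancel₀ _ (by linarith [hb.ratioMultiplier_lt_one])
  have h4 : θ₁ / 2 * (2 * 1) / (θ₁ / 2 * (1 + 2 * fixedRatio θ₁ θ₂)) =
      2 / (1 + 2 * fixedRatio θ₁ θ₂) := by
    field_simp
  rw [h4, ← h3]
  ring

theorem hasDerivAt_profile :
    HasDerivAt (fun u => potential θ₁ θ₂ ![1, u]) (profileSlope θ₁ θ₂) (fixedRatio θ₁ θ₂) := by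
  have hp := hb.fixedRatio_pos
  rw [hasDerivAt_iff_isLittleO, Asymptotics.isLittleO_iff]
  intro ε hε
  have hdef := (hasDerivAt_iff_isLittleO.1 hb.hasDerivAt_defect).def hε
  obtain ⟨δ, hδ, hball⟩ := Metric.eventually_nhds_iff.1 hdef
  set p := fixedRatio θ₁ θ₂ with hpdef
  set d := profileSlope θ₁ θ₂ with hd
  -- The Lipschitz bound starts the induction with error constant 2/p + d. The functional equation
  -- gives 2 · error(u) ≤ ε|u - p| + error(g(u)), where g does not increase the distance to p; each
  -- step therefore halves the excess over ε.
  have key : ∀ m : ℕ, ∀ u, |u - p| < min δ (p / 2) →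
      |potential θ₁ θ₂ ![1, u] - potential θ₁ θ₂ ![1, p] - (u - p) * d| ≤
        (ε + (1 / 2) ^ m * (2 / p + d)) * |u - p| := by
    intro m
    induction m with
    | zero =>
      intro u hu
      have h1 := hb.abs_profile_sub_le (hu.trans_le (min_le_right _ _))
      have h2 := abs_sub (potential θ₁ θ₂ ![1, u] - potential θ₁ θ₂ ![1, p]) ((u - p) * d)
      rw [abs_mul, abs_of_pos hb.profileSlope_pos] at h2
      have h3 := mul_nonneg hε.le (abs_nonneg (u - p))
      rw [pow_zero]
      nlinarith
    | succ m ih =>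
      intro u hu
      have hu0 : 0 < u := by
        have := (abs_lt.1 (hu.trans_le (min_le_right _ _))).1
        linarith
      have hg := hb.abs_ratioMap_sub_le_self hu0
      have h1 := ih (ratioMap θ₁ θ₂ u) (hg.trans_lt hu)
      have h2 := hball (y := u) (by rw [Real.dist_eq]; exact hu.trans_le (min_le_left _ _))
      have e1 := hb.two_mul_profile hu0
      have e2 := hb.two_mul_profile hp
      rw [hb.ratioMap_fixedRatio] at e2 h2
      rw [smul_zero, sub_zero, Real.norm_eq_abs, Real.norm_eq_abs] at h2
      have hd0 := hb.profileSlope_pos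
      have h3 : (ε + (1 / 2) ^ m * (2 / p + d)) * |ratioMap θ₁ θ₂ u - p| ≤
          (ε + (1 / 2) ^ m * (2 / p + d)) * |u - p| :=
        mul_le_mul_of_nonneg_left hg (by positivity)
      have h4 := (abs_add_le _ _).trans (add_le_add h2 (h1.trans h3))
      have e3 : Real.log (θ₁ / 2 * (1 + 2 * u)) - 2 * d * u + d * ratioMap θ₁ θ₂ u -
          (Real.log (θ₁ / 2 * (1 + 2 * p)) - 2 * d * p + d * p) +
          (potential θ₁ θ₂ ![1, ratioMap θ₁ θ₂ u] - potential θ₁ θ₂ ![1, p] -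
            (ratioMap θ₁ θ₂ u - p) * d) =
          2 * (potential θ₁ θ₂ ![1, u] - potential θ₁ θ₂ ![1, p] - (u - p) * d) := by
        linear_combination e2 - e1
      rw [e3, abs_mul, abs_two] at h4
      rw [pow_succ]
      linarith
  have hmem : ∀ᶠ u in 𝓝 p, |u - p| < min δ (p / 2) :=
    Metric.eventually_nhds_iff.2
      ⟨min δ (p / 2), lt_min hδ (by positivity), fun _ h => by rwa [Real.dist_eq] at h⟩
  filter_upwards [hmem] with u hu
  have hlim : Tendsto (fun m : ℕ => (ε + (1 / 2 : ℝ) ^ m * (2 / p + d)) * |u - p|) atTop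
      (𝓝 ((ε + 0 * (2 / p + d)) * |u - p|)) :=
    (((tendsto_pow_atTop_nhds_zero_of_lt_one (by norm_num) (by norm_num)).mul_const _).const_add
      ε).mul_const _
  have := ge_of_tendsto' hlim fun m => key m u hu
  simpa using this

theorem posFixedPoint_zero_lt : posFixedPoint θ₁ θ₂ 0 < 2 / θ₁ := by
  have h1 := hb.pos₁
  have h2 := hb.pos₂
  simp only [posFixedPoint, Matrix.cons_val_zero]
  rw [div_lt_div_iff₀ (by positivity) h1]
  nlinarith [mul_pos h1 (sub_pos.2 hb.lt₁)]

theorem ratio_posFixedPoint :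
    posFixedPoint θ₁ θ₂ 1 / posFixedPoint θ₁ θ₂ 0 = fixedRatio θ₁ θ₂ := by
  rw [hb.posFixedPoint_one, mul_div_cancel_left₀ _ hb.posFixedPoint_zero_pos.ne']

theorem fst_eq_exp {x : Fin 2 → ℝ} (h0 : 0 < x 0) (h1 : 0 ≤ x 1)
    (hx : potential θ₁ θ₂ x = 0) : Real.exp (-potential θ₁ θ₂ ![1, x 1 / x 0]) = x 0 := by
  simpa using (congrFun (hb.eq_exp_smul h0 h1 hx) 0).symm

/-- With r = θ₂/θ₁, it combines λ(1 + 2p) = 1 + rp with the fixed-point equation r(p + 2) = 1 + 2p.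
-/
theorem fixedRatio_sub_inv_profileSlope :
    fixedRatio θ₁ θ₂ - (profileSlope θ₁ θ₂)⁻¹ = -(θ₂ / θ₁) := by
  have hp := hb.fixedRatio_pos
  have h : ratioMultiplier θ₁ θ₂ * (1 + 2 * fixedRatio θ₁ θ₂) =
      1 + θ₂ / θ₁ * fixedRatio θ₁ θ₂ := div_mul_cancel₀ _ (by positivity)
  have hg := hb.ratioMap_fixedRatio
  rw [ratioMap, div_eq_iff (by positivity)] at hg
  have hg' : θ₂ / θ₁ * (fixedRatio θ₁ θ₂ + 2) = 1 + 2 * fixedRatio θ₁ θ₂ :=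
    mul_left_cancel₀ hp.ne' (by linear_combination hg)
  rw [profileSlope, inv_div, div_div_eq_mul_div]
  linear_combination h / 2 + hg' / 2

/-- On the curve t = exp(-φ(γ(t)/t)), so the continuous function γ(t)/t locally inverts a map with
nonzero derivative; multiplying by t gives γ. -/
theorem hasDerivAt_of_isStableCurve {γ : ℝ → ℝ} (hγ : IsStableCurve θ₁ θ₂ γ) :
    HasDerivAt γ (-(θ₂ / θ₁)) (posFixedPoint θ₁ θ₂ 0) := by
  obtain ⟨s, hs⟩ : ∃ s, s = posFixedPoint θ₁ θ₂ 0 := ⟨_, rfl⟩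
  have hs0 := hb.posFixedPoint_zero_pos
  have hs1 := hb.posFixedPoint_zero_lt
  rw [← hs] at hs0 hs1 ⊢
  have hcont : ContinuousAt γ s := hγ.continuousOn.continuousAt (Icc_mem_nhds hs0 hs1)
  have hu : ContinuousAt (fun t => γ t / t) s := hcont.div continuousAt_id hs0.ne'
  have hus : γ s / s = fixedRatio θ₁ θ₂ := by
    rw [hs, hγ.through_E, hb.ratio_posFixedPoint]
  have hXs : Real.exp (-potential θ₁ θ₂ ![1, fixedRatio θ₁ θ₂]) = s := by
    rw [← hb.ratio_posFixedPoint, hs]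
    exact hb.fst_eq_exp hb.posFixedPoint_zero_pos hb.posFixedPoint_one_pos.le
      hb.potential_posFixedPoint
  have hd := hb.profileSlope_pos
  have hX : HasDerivAt (fun u => Real.exp (-potential θ₁ θ₂ ![1, u]))
      (s * -profileSlope θ₁ θ₂) (γ s / s) := by
    have h := hb.hasDerivAt_profile.fun_neg.exp
    rwa [hXs, ← hus] at h
  have hev : ∀ᶠ t in 𝓝 s, Real.exp (-potential θ₁ θ₂ ![1, γ t / t]) = t := by
    filter_upwards [Ioo_mem_nhds hs0 hs1] with t ht
    have hmem : ![t, γ t] ∈ stableSet (quadOp ![θ₁, θ₂]) (posFixedPoint θ₁ θ₂) := by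
      rw [← hγ.stable]
      exact ⟨t, ht, rfl⟩
    obtain ⟨h0, h1, hz⟩ := hb.mem_stableSet_iff.1 hmem
    have h := hb.fst_eq_exp h0 h1.le hz
    rwa [Matrix.cons_val_zero, Matrix.cons_val_one, Matrix.cons_val_zero] at h
  have hinv : HasDerivAt (fun t => γ t / t) (s * -profileSlope θ₁ θ₂)⁻¹ s :=
    HasDerivAt.of_local_left_inverse hu hX (mul_ne_zero hs0.ne' (neg_ne_zero.2 hd.ne')) hev
  have hmul : HasDerivAt (fun t => t * (γ t / t))
      (1 * (γ s / s) + s * (s * -profileSlope θ₁ θ₂)⁻¹) s :=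
    (hasDerivAt_id s).fun_mul hinv
  refine (hmul.congr_of_eventuallyEq ?_).congr_deriv ?_
  · filter_upwards [lt_mem_nhds hs0] with t ht
    exact (mul_div_cancel₀ _ ht.ne').symm
  · rw [← hb.fixedRatio_sub_inv_profileSlope, hus]
    field_simp
    ring

end BalancedRates

/-! ### Linearization at the positive fixed point -/

theorem hasFDerivAt_quadOp_two (θ₁ θ₂ : ℝ) (x : Fin 2 → ℝ) :
    HasFDerivAt (quadOp ![θ₁, θ₂])
      (Matrix.toLin'
        !![θ₁ * (x 0 + x 1), θ₁ * x 0; θ₂ * x 1, θ₂ * (x 0 + x 1)]).toContinuousLinearMap x := by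
  have h0 : HasFDerivAt (fun y : Fin 2 → ℝ => y 0) (ContinuousLinearMap.proj (R := ℝ) 0) x :=
    hasFDerivAt_apply 0 x
  have h1 : HasFDerivAt (fun y : Fin 2 → ℝ => y 1) (ContinuousLinearMap.proj (R := ℝ) 1) x :=
    hasFDerivAt_apply 1 x
  rw [hasFDerivAt_pi']
  intro i
  fin_cases i
  · refine (((h0.const_mul (θ₁ / 2)).mul (h0.add (h1.const_mul 2))).congr_fderiv
      ?_).congr_of_eventuallyEq (.of_forall fun y => ?_)
    · ext v
      simp [dotProduct, Fin.sum_univ_two]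
      ring
    · show quadOp ![θ₁, θ₂] y 0 = θ₁ / 2 * y 0 * (y 0 + 2 * y 1)
      rw [quadOp_two_zero]
      ring
  · refine (((h1.const_mul (θ₂ / 2)).mul (h1.add (h0.const_mul 2))).congr_fderiv
      ?_).congr_of_eventuallyEq (.of_forall fun y => ?_)
    · ext v
      simp [dotProduct, Fin.sum_univ_two]
      ring
    · show quadOp ![θ₁, θ₂] y 1 = θ₂ / 2 * y 1 * (y 1 + 2 * y 0)
      rw [quadOp_two_one]
      ring

theorem jacobian_quadOp_two (θ₁ θ₂ : ℝ) (x : Fin 2 → ℝ) :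
    jacobian (quadOp ![θ₁, θ₂]) x =
      !![θ₁ * (x 0 + x 1), θ₁ * x 0; θ₂ * x 1, θ₂ * (x 0 + x 1)] := by
  rw [jacobian, (hasFDerivAt_quadOp_two θ₁ θ₂ x).fderiv]
  exact LinearMap.toMatrix'_toLin' _

/-- The eigenvalue of modulus less than one at the positive fixed point. -/
noncomputable def stableEigenvalue (θ₁ θ₂ : ℝ) : ℝ :=
  2 * (θ₁ ^ 2 + θ₂ ^ 2 - θ₁ * θ₂) / (3 * θ₁ * θ₂)

namespace BalancedRates

variable {θ₁ θ₂ : ℝ} (hb : BalancedRates θ₁ θ₂)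
include hb

theorem abs_stableEigenvalue_lt_one : |stableEigenvalue θ₁ θ₂| < 1 := by
  have h1 := hb.pos₁
  have h2 := hb.pos₂
  have h3 := mul_pos h1 h2
  rw [stableEigenvalue, abs_of_nonneg (div_nonneg (by nlinarith [sq_nonneg (θ₁ - θ₂)])
    (by positivity)), div_lt_one (by positivity)]
  -- Expanded, this product being positive is exactly the claim 2(θ₁² + θ₂² - θ₁θ₂) < 3θ₁θ₂.
  nlinarith [mul_pos hb.sub_pos₁ hb.sub_pos₂]

open Polynomial in
theorem charpoly_jacobian :
    (jacobian (quadOp ![θ₁, θ₂]) (posFixedPoint θ₁ θ₂)).charpoly =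
      (X - C 2) * (X - C (stableEigenvalue θ₁ θ₂)) := by
  have h1 := hb.pos₁.ne'
  have h2 := hb.pos₂.ne'
  have htr : (jacobian (quadOp ![θ₁, θ₂]) (posFixedPoint θ₁ θ₂)).trace =
      2 + stableEigenvalue θ₁ θ₂ := by
    rw [jacobian_quadOp_two, Matrix.trace_fin_two_of]
    simp only [posFixedPoint, stableEigenvalue, Matrix.cons_val_zero, Matrix.cons_val_one]
    field_simp
    ring
  have hdet : (jacobian (quadOp ![θ₁, θ₂]) (posFixedPoint θ₁ θ₂)).det =
      2 * stableEigenvalue θ₁ θ₂ := by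
    rw [jacobian_quadOp_two, Matrix.det_fin_two_of]
    simp only [posFixedPoint, stableEigenvalue, Matrix.cons_val_zero, Matrix.cons_val_one]
    field_simp
    ring
  rw [Matrix.charpoly_fin_two, htr, hdet, C_add, C_mul]
  ring

open Polynomial in
theorem roots_charpoly_jacobian :
    (jacobian (quadOp ![θ₁, θ₂]) (posFixedPoint θ₁ θ₂)).charpoly.roots =
      {2, stableEigenvalue θ₁ θ₂} := by
  rw [hb.charpoly_jacobian, roots_mul (mul_ne_zero (X_sub_C_ne_zero _) (X_sub_C_ne_zero _)),
    roots_X_sub_C, roots_X_sub_C]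
  rfl

open Polynomial in
theorem mem_spectrum_iff {z : ℂ} :
    z ∈ spectrum ℂ ((jacobian (quadOp ![θ₁, θ₂]) (posFixedPoint θ₁ θ₂)).map Complex.ofReal) ↔
      z = 2 ∨ z = (stableEigenvalue θ₁ θ₂ : ℂ) := by
  rw [Matrix.mem_spectrum_iff_isRoot_charpoly]
  change IsRoot (Matrix.charpoly (Matrix.map _ Complex.ofRealHom)) z ↔ _
  rw [Matrix.charpoly_map, hb.charpoly_jacobian]
  simp [sub_eq_zero]

theorem isSaddle : IsSaddle (quadOp ![θ₁, θ₂]) (posFixedPoint θ₁ θ₂) where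
  fixed := hb.quadOp_posFixedPoint
  differentiable := (hasFDerivAt_quadOp_two θ₁ θ₂ _).differentiableAt
  hyperbolic z hz := by
    rcases hb.mem_spectrum_iff.1 hz with rfl | rfl
    · simp
    · rw [Complex.norm_real]
      exact hb.abs_stableEigenvalue_lt_one.ne
  stable := ⟨_, hb.mem_spectrum_iff.2 (.inr rfl), by
    rw [Complex.norm_real]
    exact hb.abs_stableEigenvalue_lt_one⟩
  unstable := ⟨_, hb.mem_spectrum_iff.2 (.inl rfl), by simp⟩

theorem hasEigenvector_jacobian :
    Module.End.HasEigenvector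
      (Matrix.toLin' (jacobian (quadOp ![θ₁, θ₂]) (posFixedPoint θ₁ θ₂)))
      (stableEigenvalue θ₁ θ₂) ![1, -(θ₂ / θ₁)] := by
  have h1 := hb.pos₁.ne'
  have h2 := hb.pos₂.ne'
  refine ⟨Module.End.mem_eigenspace_iff.2 ?_, fun h => one_ne_zero (congrFun h 0)⟩
  rw [jacobian_quadOp_two, Matrix.toLin'_apply]
  ext i
  fin_cases i
  · simp [posFixedPoint, stableEigenvalue, Matrix.mulVec, dotProduct, Fin.sum_univ_two]
    field_simp
    ring
  · simp [posFixedPoint, stableEigenvalue, Matrix.mulVec, dotProduct, Fin.sum_univ_two]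
    field_simp
    ring

end BalancedRates

theorem mainTheorem12 (θ₁ θ₂ : ℝ) (hθ₁ : 0 < θ₁) (hθ₂ : 0 < θ₂)
    (h₁₂ : θ₁ < 2 * θ₂) (h₂₁ : θ₂ < 2 * θ₁) :
    -- the fixed point is a saddle
    IsSaddle (quadOp ![θ₁, θ₂]) (posFixedPoint θ₁ θ₂) ∧
    -- the eigenvalues of the Jacobian matrix at it
    (jacobian (quadOp ![θ₁, θ₂]) (posFixedPoint θ₁ θ₂)).charpoly.roots =
      {2, 2 * (θ₁ ^ 2 + θ₂ ^ 2 - θ₁ * θ₂) / (3 * θ₁ * θ₂)} ∧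
    |2 * (θ₁ ^ 2 + θ₂ ^ 2 - θ₁ * θ₂) / (3 * θ₁ * θ₂)| < 1 ∧
    -- the eigenvector of the second eigenvalue
    Module.End.HasEigenvector
      (Matrix.toLin' (jacobian (quadOp ![θ₁, θ₂]) (posFixedPoint θ₁ θ₂)))
      (2 * (θ₁ ^ 2 + θ₂ ^ 2 - θ₁ * θ₂) / (3 * θ₁ * θ₂)) ![1, -(θ₂ / θ₁)] ∧
    -- the stable curve exists, and the eigenvector is its tangent vector at the fixed point
    (∃ γ : ℝ → ℝ, IsStableCurve θ₁ θ₂ γ) ∧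
    ∀ γ : ℝ → ℝ, IsStableCurve θ₁ θ₂ γ →
      HasDerivAt (fun s : ℝ => (![s, γ s] : Fin 2 → ℝ)) ![1, -(θ₂ / θ₁)]
        (posFixedPoint θ₁ θ₂ 0) := by
  have hb : BalancedRates θ₁ θ₂ := ⟨hθ₁, hθ₂, h₁₂, h₂₁⟩
  refine ⟨hb.isSaddle, hb.roots_charpoly_jacobian, hb.abs_stableEigenvalue_lt_one,
    hb.hasEigenvector_jacobian, hb.exists_isStableCurve, fun γ hγ => hasDerivAt_pi.2 fun i => ?_⟩
  fin_cases i
  · exact hasDerivAt_id _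
  · exact hb.hasDerivAt_of_isStableCurve hγ
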